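/- Words are one-sided infinite: for a finite alphabet $\Sigma$, a word is an element $\mathbf{x}=x_0x_1x_2\cdots$ of $\Sigma^{\mathbb N}$, and $\mathcal L(\mathbf{x})$ denotes the set of its finite factors (blocks of consecutive letters). A word is aperiodic if it is not ultimately periodic. The abelian closure of $\mathbf{x}\in\Sigma^{\mathbb N}$ is the set $$\mathcal A_{\mathbf x}=\{\mathbf y\in\Sigma^{\mathbb N} : \text{for each } u\in\mathcal L(\mathbf y) \text{ there is } v\in\mathcal L(\mathbf x) \text{ in which each letter occurs as often as in } u\}.$$ A subshift is a non-empty closed set $X\subseteq\Sigma^{\mathbb N}$ (in the product topology, $\Sigma$ being discrete) with $\sigma(X)\subseteq X$, where $\sigma(a_0a_1a_2\cdots)=a_1a_2\cdots$; it is minimal if it contains no proper subshift. A Sturmian word is an aperiodic word over $\{0,1\}$ that has exactly $n+1$ distinct factors of length $n$ for each $n\ge 0$. For a word $\mathbf s$ over $\{0,1\}$ and words $\mathbf z_0,\mathbf z_1$, let $\mathcal S(\mathbf s,\mathbf z_0,\mathbf z_1)$ be the word obtained from $\mathbf s$ by replacing, for every $n$, the $n$th occurrence of $0$ (resp. $1$)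 by the $n$th letter of $\mathbf z_0$ (resp. $\mathbf z_1$). Finally $v^\omega=vvv\cdots$ for a non-empty finite word $v$. **Proposition.** For each integer $k\ge 1$ there exists an aperiodic word $\mathbf x_k$ over a three-letter alphabet such that $\mathcal A_{\mathbf x_k}$ is the union of exactly $k$ distinct minimal subshifts. Moreover, for each $k\ge1$ and every Sturmian word $\mathbf s$, the word $$\mathbf x_k=\mathcal S\bigl(\mathbf s,(0^{2k-1}11)^\omega,a^\omega\bigr)$$ over the alphabet $\{0,1,a\}$ is aperiodic and has this property. -/

import Mathlib

namespace AbelianClosure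

/-- The block `x_i x_{i+1} ⋯ x_{i+n-1}` of the infinite word `x`. -/
def block {α : Type*} (x : ℕ → α) (i n : ℕ) : List α :=
  List.ofFn fun j : Fin n => x (i + j)

/-- The language of `x`: the set of all its (finite) factors, the empty word included. -/
def language {α : Type*} (x : ℕ → α) : Set (List α) :=
  {w | ∃ i n : ℕ, w = block x i n}

/-- The set of factors of `x` of length `n`. -/
def languageOfLength {α : Type*} (n : ℕ) (x : ℕ → α) : Set (List α) :=
  {w | w ∈ language x ∧ w.length = n}

/-- Two finite words are abelian equivalent if each letter occurs equally often in both. -/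
def AbelianEquiv {α : Type*} [DecidableEq α] (u v : List α) : Prop :=
  ∀ a : α, u.count a = v.count a

/-- The abelian closure of the infinite word `x`: all infinite words each of whose factors is
abelian equivalent to some factor of `x`. -/
def abelianClosure {α : Type*} [DecidableEq α] (x : ℕ → α) : Set (ℕ → α) :=
  {y | ∀ u ∈ language y, ∃ v ∈ language x, AbelianEquiv u v}

/-- The shift operator `a₀a₁a₂⋯ ↦ a₁a₂⋯`. -/
def shift {α : Type*} (x : ℕ → α) : ℕ → α := fun n => x (n + 1)

/-- A subshift: a non-empty set of infinite words that is closed in the product topology (the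
alphabet being discrete) and is mapped into itself by the shift operator. -/
def IsSubshift {α : Type*} [TopologicalSpace α] [DiscreteTopology α] (X : Set (ℕ → α)) : Prop :=
  X.Nonempty ∧ IsClosed X ∧ shift '' X ⊆ X

/-- A subshift that contains no proper subshift. -/
def IsMinimalSubshift {α : Type*} [TopologicalSpace α] [DiscreteTopology α]
    (X : Set (ℕ → α)) : Prop :=
  IsSubshift X ∧ ∀ Y : Set (ℕ → α), IsSubshift Y → Y ⊆ X → Y = X

/-- `X` is the union of exactly `k` (pairwise) distinct minimal subshifts. -/
def IsUnionOfDistinctMinimalSubshifts {α : Type*} [TopologicalSpace α] [DiscreteTopology α]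
    (k : ℕ) (X : Set (ℕ → α)) : Prop :=
  ∃ M : Fin k → Set (ℕ → α),
    Function.Injective M ∧ (∀ i, IsMinimalSubshift (M i)) ∧ X = ⋃ i, M i

/-- `x` is aperiodic: it is not ultimately periodic (in particular, not periodic). -/
def IsAperiodic {α : Type*} (x : ℕ → α) : Prop :=
  ¬ ∃ N p : ℕ, 0 < p ∧ ∀ n, N ≤ n → x (n + p) = x n

/-- A Sturmian word: an aperiodic infinite binary word that has exactly `n + 1` distinct factors
of each length `n`. -/
def IsSturmian (s : ℕ → Fin 2) : Prop :=
  IsAperiodic s ∧ ∀ n : ℕ, (languageOfLength n s).ncard = n + 1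

/-- The infinite word `v^ω = v v v ⋯` for a non-empty finite word `v`. -/
def omegaPower {α : Type*} (v : List α) (hv : v ≠ []) : ℕ → α :=
  fun n => v[n % v.length]'(Nat.mod_lt n (List.length_pos_iff.mpr hv))

/-- The word `S(x, z₀, z₁)`, obtained from the infinite binary word `x` by replacing the `n`th
occurrence of `0` (resp. `1`) in `x` by the `n`th letter of `z₀` (resp. `z₁`). At a position `i`
with `x i = 0` the number of earlier occurrences of `0` is the index of the letter of `z₀`
that is placed there, counted from `0`; similarly for `1`. -/
def substituteWords {α : Type*} (x : ℕ → Fin 2) (z₀ z₁ : ℕ → α) : ℕ → α :=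
  fun i =>
    if x i = 0 then z₀ (Nat.count (fun j => x j = 0) i)
    else z₁ (Nat.count (fun j => x j = 1) i)

end AbelianClosure

namespace AbelianClosure

/-! Put K = 2k + 1. The letter counts of a factor of `fillZeros s w` record the number of zeros in a
factor of the binary skeleton s, its length, and the number of ones in a window of the filling w.
For a word in the closure, the first data force its skeleton to have the slope of s. The last force
every window of K letters of its filling to contain two ones, so the filling is K-periodic with two
ones per period; as K is odd, their cyclic distance can be taken as some d in 1, ..., k
(`exists_iff_isPair_add`). Conversely every such d occurs, because a pair of adjacent ones already
attains each window count that a pair at distance d attains (`exists_count_isPair_one_eq`).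

Skeleton and phase of the filling are independent: for irrational slope β the multiples of β are
dense modulo K, so each binary factor occurs after a number of zeros in any residue class modulo K
(`HasSlope.exists_zeros_eq`). For fixed β the language of a filled word thus depends on d alone. The
k languages are pairwise incomparable (`eq_of_language_subset`), and each defines one minimal
subshift.

Sturmian words enter only through their slope, which exists by balance (`IsSturmian.isBalanced`) and
is irrational by aperiodicity (`IsBalanced.irrational_of_isAperiodic`). -/

/-- The number of zeros among the first `i` letters of `t`. -/
def zeros (t : ℕ → Fin 2) (i : ℕ) : ℕ := Nat.count (fun j => t j = 0) i

theorem zeros_succ (t : ℕ → Fin 2) (i : ℕ) :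
    zeros t (i + 1) = zeros t i + if t i = 0 then 1 else 0 :=
  Nat.count_succ _ _

theorem zeros_mono (t : ℕ → Fin 2) : Monotone (zeros t) := Nat.count_monotone _

/-! ### Words of irrational slope -/

/-- The letter `0` has frequency `β` in `t`, with all factors deviating from it by at most `1`. -/
def HasSlope (t : ℕ → Fin 2) (β : ℝ) : Prop :=
  ∀ i n : ℕ, |(zeros t (i + n) : ℝ) - zeros t i - n * β| ≤ 1

theorem HasSlope.exists_intercept {t : ℕ → Fin 2} {β : ℝ} (h : HasSlope t β) :
    ∃ ρ : ℝ, ∀ i : ℕ, (zeros t i : ℝ) ≤ i * β + ρ ∧ i * β + ρ ≤ zeros t i + 1 := by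
  have key : ∀ i j : ℕ, (zeros t j : ℝ) - j * β ≤ zeros t i - i * β + 1 := by
    intro i j
    rcases le_total i j with hij | hij
    · obtain ⟨n, rfl⟩ := Nat.exists_eq_add_of_le hij
      have := abs_le.mp (h i n)
      push_cast
      linarith
    · obtain ⟨n, rfl⟩ := Nat.exists_eq_add_of_le hij
      have := abs_le.mp (h j n)
      push_cast
      linarith
  refine ⟨⨆ i : ℕ, ((zeros t i : ℝ) - i * β), fun i => ⟨?_, ?_⟩⟩
  · have hb : BddAbove (Set.range fun i : ℕ => (zeros t i : ℝ) - i * β) :=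
      ⟨_, by rintro _ ⟨j, rfl⟩; exact key 0 j⟩
    linarith [le_ciSup hb i]
  · linarith [ciSup_le (key i)]

/-- Since β / K is irrational, the multiples of β are dense in the circle ℝ / Kℤ, and natural
multiples suffice there. Working modulo K rather than 1 is what later controls residues of zero
counts. -/
theorem exists_nat_mul_add_int_mul_mem_Ioo {β : ℝ} (hβ : Irrational β) {K : ℕ} (hK : 0 < K)
    {a b : ℝ} (hab : a < b) : ∃ (i : ℕ) (m : ℤ), a < i * β + m * K ∧ i * β + m * K < b := by
  have : Fact (0 < (K : ℝ)) := ⟨by exact_mod_cast hK⟩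
  have hd : DenseRange (fun n : ℤ => n • (β : AddCircle (K : ℝ))) :=
    AddCircle.denseRange_zsmul_coe_iff.mpr (hβ.div_natCast hK.ne')
  rw [denseRange_zsmul_iff_nsmul] at hd
  have ho : IsOpen ((fun x : ℝ => (x : AddCircle (K : ℝ))) '' Set.Ioo a b) :=
    QuotientAddGroup.isOpenMap_coe _ isOpen_Ioo
  obtain ⟨i, x, hx, hxi⟩ := hd.exists_mem_open ho ((Set.nonempty_Ioo.mpr hab).image _)
  have hxi' : ((x : ℝ) : AddCircle (K : ℝ)) = ((i * β : ℝ) : AddCircle (K : ℝ)) := by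
    simpa using hxi
  rw [← sub_eq_zero, ← AddCircle.coe_sub, AddCircle.coe_eq_zero_iff] at hxi'
  obtain ⟨m, hm⟩ := hxi'
  rw [zsmul_eq_mul] at hm
  refine ⟨i, m, ?_⟩
  constructor <;> linarith [hx.1, hx.2]

theorem exists_pos_forall_le_of_pos (n : ℕ) (f : ℕ → ℝ) (hf : ∀ j ≤ n, 0 < f j) :
    ∃ ε > 0, ∀ j ≤ n, ε ≤ f j := by
  obtain ⟨j, hj, hmin⟩ := Finset.exists_min_image (Finset.range (n + 1)) f ⟨0, by simp⟩
  refine ⟨f j, hf j (by simpa [Nat.lt_succ_iff] using hj), fun i hi => hmin i ?_⟩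
  simpa [Nat.lt_succ_iff] using hi

/-- Words with the same irrational slope have the same factors, and each factor occurs after
a number of zeros in any prescribed residue class. -/
theorem HasSlope.exists_zeros_eq {t t' : ℕ → Fin 2} {β : ℝ} (hβ : Irrational β)
    (h : HasSlope t β) (h' : HasSlope t' β) {K : ℕ} (hK : 0 < K) (r : ℤ) (i n : ℕ) :
    ∃ (i' : ℕ) (m : ℤ), ∀ j ≤ n, (zeros t' (i' + j) : ℤ) = zeros t (i + j) + r + m * K := by
  obtain ⟨ρ, hρ⟩ := h.exists_intercept
  obtain ⟨ρ', hρ'⟩ := h'.exists_intercept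
  -- The intercept bounds are not strict, but the lower and the upper one are never both attained:
  -- subtracting the two equalities would make a nonzero multiple of β an integer. So moving ρ
  -- slightly in one direction makes all bounds on the window strict.
  obtain ⟨a, b, hab, hI⟩ : ∃ a b : ℝ, a < b ∧ ∀ δ, a < δ → δ < b → ∀ j ≤ n,
      (zeros t (i + j) : ℝ) < (i + j : ℕ) * β + ρ + δ ∧
      (i + j : ℕ) * β + ρ + δ < zeros t (i + j) + 1 := by
    by_cases hlt : ∀ j ≤ n, 0 < (zeros t (i + j) : ℝ) + 1 - ((i + j : ℕ) * β + ρ)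
    · obtain ⟨ε, hε, hle⟩ := exists_pos_forall_le_of_pos n _ hlt
      refine ⟨0, ε, hε, fun δ h0 h1 j hj => ?_⟩
      constructor <;> linarith [hle j hj, (hρ (i + j)).1]
    · push Not at hlt
      obtain ⟨q, hq, hq'⟩ := hlt
      have hgt : ∀ j ≤ n, 0 < ((i + j : ℕ) * β + ρ) - (zeros t (i + j) : ℝ) := by
        intro j hj
        by_contra hneg
        have e1 : ((i + q : ℕ) : ℝ) * β + ρ = zeros t (i + q) + 1 :=
          le_antisymm (hρ _).2 (by linarith)
        have e2 : ((i + j : ℕ) : ℝ) * β + ρ = zeros t (i + j) :=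
          le_antisymm (by linarith) (hρ _).1
        have hqj : ((q : ℤ) - j) ≠ 0 := by
          intro h0
          have : q = j := by omega
          subst this
          linarith
        have hirr := hβ.intCast_mul hqj
        apply hirr.ne_int ((zeros t (i + q) : ℤ) + 1 - zeros t (i + j))
        push_cast at e1 e2 ⊢
        linarith
      obtain ⟨ε, hε, hle⟩ := exists_pos_forall_le_of_pos n _ hgt
      refine ⟨-ε, 0, by linarith, fun δ h0 h1 j hj => ?_⟩
      constructor <;> linarith [hle j hj, (hρ (i + j)).2]
  obtain ⟨i', m, h1, h2⟩ := exists_nat_mul_add_int_mul_mem_Ioo hβ hK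
    (show a + (i * β + ρ + r - ρ') < b + (i * β + ρ + r - ρ') by linarith)
  refine ⟨i', -m, fun j hj => ?_⟩
  -- Here δ is the error of the approximation; the strict bounds leave a single integer value for
  -- the zero count of t'.
  obtain ⟨h3, h4⟩ := hI (i' * β + m * K - (i * β + ρ + r - ρ')) (by linarith) (by linarith) j hj
  obtain ⟨h5, h6⟩ := hρ' (i' + j)
  have h7 : ((zeros t' (i' + j) : ℤ) : ℝ) <
      ((zeros t (i + j) + r + -m * K + 1 : ℤ) : ℝ) := by
    push_cast at *
    linarith
  have h8 : ((zeros t (i + j) + r + -m * K - 1 : ℤ) : ℝ) < ((zeros t' (i' + j) : ℤ) : ℝ) := by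
    push_cast at *
    linarith
  have := Int.cast_lt.mp h7
  have := Int.cast_lt.mp h8
  omega

/-! ### Factors and letter counts -/

theorem block_eq_block_iff {α : Type*} {x y : ℕ → α} {i j n : ℕ} :
    block x i n = block y j n ↔ ∀ m < n, x (i + m) = y (j + m) := by
  simp only [block, List.ofFn_inj, funext_iff, Fin.forall_iff]

theorem count_block {α : Type*} [DecidableEq α] (x : ℕ → α) (i n : ℕ) (a : α) :
    (block x i n).count a = Nat.count (fun j => x (i + j) = a) n := by
  induction n with
  | zero => simp [block]
  | succ n ih =>
    have : block x i (n + 1) = block x i n ++ [x (i + n)] := by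
      rw [block, List.ofFn_succ', List.concat_eq_append]
      simp [block]
    rw [this, List.count_append, ih, Nat.count_succ, List.count_singleton]
    simp

theorem length_block {α : Type*} (x : ℕ → α) (i n : ℕ) : (block x i n).length = n := by
  simp [block]

theorem AbelianEquiv.length_eq {α : Type*} [DecidableEq α] {u v : List α}
    (h : AbelianEquiv u v) : u.length = v.length :=
  (List.perm_iff_count.mpr h).length_eq

theorem mem_abelianClosure_iff {α : Type*} [DecidableEq α] {x y : ℕ → α} :
    y ∈ abelianClosure x ↔ ∀ i n, ∃ j, ∀ a,
      Nat.count (fun m => y (i + m) = a) n = Nat.count (fun m => x (j + m) = a) n := by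
  constructor
  · intro h i n
    obtain ⟨_, ⟨j, n', rfl⟩, hv⟩ := h _ ⟨i, n, rfl⟩
    obtain rfl : n = n' := by simpa [length_block] using hv.length_eq
    exact ⟨j, fun a => by simpa [count_block] using hv a⟩
  · rintro h _ ⟨i, n, rfl⟩
    obtain ⟨j, hj⟩ := h i n
    exact ⟨_, ⟨j, n, rfl⟩, fun a => by simpa [count_block] using hj a⟩

/-! ### Words over `Fin 3` as a binary word with its zeros replaced -/

/-- The word obtained from `t` by replacing the `n`th zero by `z n` and each one by `2`. -/
def fillZeros (t : ℕ → Fin 2) (z : ℕ → Fin 3) : ℕ → Fin 3 :=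
  fun i => if t i = 0 then z (zeros t i) else 2

theorem fillZeros_eq_substituteWords (t : ℕ → Fin 2) (z : ℕ → Fin 3) :
    fillZeros t z = substituteWords t z fun _ => 2 := rfl

theorem count_fillZeros_one (t : ℕ → Fin 2) (z : ℕ → Fin 3) (i n : ℕ) :
    Nat.count (fun m => fillZeros t z (i + m) = 1) n =
      Nat.count (fun m => z (zeros t i + m) = 1) (zeros t (i + n) - zeros t i) := by
  induction n with
  | zero => simp
  | succ n ih =>
    have hle := zeros_mono t (Nat.le_add_right i n)
    rw [Nat.count_succ, ih, ← Nat.add_assoc, zeros_succ]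
    by_cases h : t (i + n) = 0
    · simp only [fillZeros, h, if_true, Nat.sub_add_comm hle, Nat.count_succ,
        Nat.add_sub_cancel' hle]
    · simp [fillZeros, h]

theorem count_fillZeros_two (t : ℕ → Fin 2) {z : ℕ → Fin 3} (hz : ∀ m, z m ≠ 2) (i n : ℕ) :
    Nat.count (fun m => fillZeros t z (i + m) = 2) n + (zeros t (i + n) - zeros t i) = n := by
  induction n with
  | zero => simp
  | succ n ih =>
    have hle := zeros_mono t (Nat.le_add_right i n)
    rw [Nat.count_succ, ← Nat.add_assoc, zeros_succ]
    by_cases h : t (i + n) = 0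
    · simp only [fillZeros, h, hz, if_true, if_false]
      simp only [fillZeros] at ih
      omega
    · simp only [fillZeros, h, if_true, if_false]
      simp only [fillZeros] at ih
      omega

theorem count_fin_three (y : ℕ → Fin 3) (n : ℕ) :
    Nat.count (fun m => y m = 0) n + Nat.count (fun m => y m = 1) n +
      Nat.count (fun m => y m = 2) n = n := by
  induction n with
  | zero => simp
  | succ n ih =>
    simp only [Nat.count_succ]
    have : y n = 0 ∨ y n = 1 ∨ y n = 2 := by generalize y n = a; revert a; decide
    rcases this with h | h | h <;> simp [h] <;> omega

theorem fillZeros_mem_abelianClosure_iff {t s : ℕ → Fin 2} {z w : ℕ → Fin 3}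
    (hz : ∀ m, z m ≠ 2) (hw : ∀ m, w m ≠ 2) :
    fillZeros t z ∈ abelianClosure (fillZeros s w) ↔ ∀ i n, ∃ j,
      zeros t (i + n) - zeros t i = zeros s (j + n) - zeros s j ∧
      Nat.count (fun m => z (zeros t i + m) = 1) (zeros t (i + n) - zeros t i) =
        Nat.count (fun m => w (zeros s j + m) = 1) (zeros s (j + n) - zeros s j) := by
  rw [mem_abelianClosure_iff]
  refine forall₂_congr fun i n => exists_congr fun j => ?_
  have ht := count_fillZeros_two t hz i n
  have hs := count_fillZeros_two s hw j n
  have ht' := count_fin_three (fun m => fillZeros t z (i + m)) n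
  have hs' := count_fin_three (fun m => fillZeros s w (j + m)) n
  rw [← count_fillZeros_one, ← count_fillZeros_one]
  constructor
  · intro h
    exact ⟨by have := h 2; omega, h 1⟩
  · rintro ⟨h2, h1⟩ a
    have ha : a = 0 ∨ a = 1 ∨ a = 2 := by revert a; decide
    rcases ha with rfl | rfl | rfl <;> omega

theorem HasSlope.slope_pos {t : ℕ → Fin 2} {β : ℝ} (hβ : Irrational β) (h : HasSlope t β) :
    0 < β := by
  by_contra hneg
  have hlt : 0 < -β := by
    rcases (not_lt.mp hneg).lt_or_eq with h0 | h0
    · linarith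
    · exact absurd h0 (by simpa using hβ.ne_int 0)
  obtain ⟨n, hn⟩ := Archimedean.arch (2 : ℝ) hlt
  rw [nsmul_eq_mul] at hn
  have := (abs_le.mp (h 0 n)).2
  have h0 : (zeros t 0 : ℝ) = 0 := by simp [zeros]
  have h1 : (0 : ℝ) ≤ zeros t (0 + n) := Nat.cast_nonneg _
  rw [h0] at this
  linarith

theorem HasSlope.infinite_zeros {t : ℕ → Fin 2} {β : ℝ} (hβ : Irrational β) (h : HasSlope t β) :
    {i | t i = 0}.Infinite := by
  intro hfin
  obtain ⟨n, hn⟩ := Archimedean.arch ((hfin.toFinset.card : ℝ) + 2) (h.slope_pos hβ)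
  rw [nsmul_eq_mul] at hn
  have h1 : (zeros t (0 + n) : ℝ) ≤ hfin.toFinset.card := by
    exact_mod_cast Nat.count_le_card hfin (0 + n)
  have := (abs_le.mp (h 0 n)).1
  have h0 : (0 : ℝ) ≤ zeros t 0 := Nat.cast_nonneg _
  linarith

/-- The binary word marking by `1` the positions of the letter `2`. -/
def support (y : ℕ → Fin 3) : ℕ → Fin 2 := fun i => if y i = 2 then 1 else 0

theorem fillZeros_support (y : ℕ → Fin 3) :
    fillZeros (support y) (fun m => y (Nat.nth (fun i => support y i = 0) m)) = y := by
  funext i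
  by_cases h : y i = 2
  · simp [fillZeros, support, h]
  · have h0 : support y i = 0 := by simp [support, h]
    simp only [fillZeros, h0, if_true, zeros]
    rw [Nat.nth_count (p := fun i => support y i = 0) h0]

theorem support_fillZeros (t : ℕ → Fin 2) {z : ℕ → Fin 3} (hz : ∀ m, z m ≠ 2) :
    support (fillZeros t z) = t := by
  funext i
  by_cases h : t i = 0
  · simp [fillZeros, support, h, hz]
  · have : t i = 1 := by omega
    simp [fillZeros, support, this]

/-! ### Periodic words with two ones per period -/

/-- Membership in the set of naturals congruent to `0` or `d` modulo `K`. -/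
def IsPair (K d m : ℕ) : Prop := m % K = 0 ∨ m % K = d

instance (K d : ℕ) : DecidablePred (IsPair K d) := fun _ => inferInstanceAs (Decidable (_ ∨ _))

theorem isPair_add_left {K d m : ℕ} : IsPair K d (K + m) ↔ IsPair K d m := by
  simp [IsPair]

theorem count_add_right_succ (p : ℕ → Prop) [DecidablePred p] (c n : ℕ) :
    Nat.count (fun j => p (c + 1 + j)) n + (if p c then 1 else 0) =
      Nat.count (fun j => p (c + j)) n + (if p (c + n) then 1 else 0) := by
  have h1 := Nat.count_succ' (p := fun j => p (c + j)) n
  have h2 := Nat.count_succ (p := fun j => p (c + j)) n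
  rw [h2] at h1
  simp only [Nat.add_zero] at h1
  rw [h1]
  simp only [Nat.add_assoc, Nat.add_comm 1]

/-- The first window is counted directly; sliding by one step drops and gains letters at congruent
positions. -/
theorem count_isPair_period {K d : ℕ} (hd : 0 < d) (hdK : d < K) (c : ℕ) :
    Nat.count (fun j => IsPair K d (c + j)) K = 2 := by
  induction c with
  | zero =>
    simp only [Nat.zero_add]
    rw [Nat.count_eq_card_filter_range]
    have : {x ∈ Finset.range K | IsPair K d x} = {0, d} := by
      ext x
      rw [Finset.mem_filter, Finset.mem_range, Finset.mem_insert, Finset.mem_singleton]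
      constructor
      · rintro ⟨hx, h⟩
        rwa [IsPair, Nat.mod_eq_of_lt hx] at h
      · rintro (rfl | rfl)
        · exact ⟨by omega, Or.inl (Nat.zero_mod K)⟩
        · exact ⟨hdK, Or.inr (Nat.mod_eq_of_lt hdK)⟩
    rw [this, Finset.card_pair hd.ne]
  | succ c ih =>
    have := count_add_right_succ (IsPair K d) c K
    rw [Nat.add_comm c K] at this
    simp only [isPair_add_left] at this
    omega

theorem count_isPair_mul_add {K d : ℕ} (hd : 0 < d) (hdK : d < K) (c q r : ℕ) :
    Nat.count (fun j => IsPair K d (c + j)) (K * q + r) =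
      2 * q + Nat.count (fun j => IsPair K d (c + j)) r := by
  induction q with
  | zero => simp
  | succ q ih =>
    rw [show K * (q + 1) + r = K + (K * q + r) by ring, Nat.count_add,
      count_isPair_period hd hdK]
    simp only [Nat.add_left_comm c K, isPair_add_left, ih]
    ring

/-- Whole periods contribute two on either side, so only a remainder r < K matters, with count 0, 1
or 2. Windows starting at 2, 1 and 0 realize these for the adjacent pair. -/
theorem exists_count_isPair_one_eq {k d : ℕ} (hd : 0 < d) (hdk : d ≤ k) (c n : ℕ) :
    ∃ c', Nat.count (fun j => IsPair (2 * k + 1) 1 (c' + j)) n =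
      Nat.count (fun j => IsPair (2 * k + 1) d (c + j)) n := by
  set K := 2 * k + 1 with hK
  have hdK : d < K := by omega
  rw [← Nat.div_add_mod n K]
  simp only [count_isPair_mul_add hd hdK, count_isPair_mul_add one_pos (show 1 < K by omega),
    Nat.add_left_cancel_iff]
  have hr : n % K < K := Nat.mod_lt _ (by omega)
  generalize n % K = r at hr
  have hle2 : ∀ d', 0 < d' → d' < K → ∀ c',
      Nat.count (fun j => IsPair K d' (c' + j)) r ≤ 2 := fun d' h0 h1 c' =>
    (Nat.count_monotone _ hr.le).trans (count_isPair_period h0 h1 c').le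
  have hW := hle2 d hd hdK c
  have hWr := Nat.count_le (p := fun j => IsPair K d (c + j)) (n := r)
  have hnone : ∀ m, 2 ≤ m → m < K → ¬ IsPair K 1 m := by
    intro m h2 hm h
    rw [IsPair, Nat.mod_eq_of_lt hm] at h
    omega
  obtain hc | hc | hc : Nat.count (fun j => IsPair K d (c + j)) r = 0 ∨
    Nat.count (fun j => IsPair K d (c + j)) r = 1 ∨
    Nat.count (fun j => IsPair K d (c + j)) r = 2 := by omega
  · rw [hc]
    refine ⟨2, Nat.count_iff_forall_not.mpr fun m hm => hnone _ (by omega) ?_⟩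
    -- The window from 2 avoids the pair unless r = K - 1, and then a count 0 would leave at most
    -- one member in a full period.
    by_contra hge
    have h1 := count_isPair_period hd hdK c
    have h2 : K = r + 1 := by omega
    rw [h2, Nat.count_succ, ← h2, hc] at h1
    split_ifs at h1 <;> omega
  · rw [hc]
    obtain ⟨r, rfl⟩ : ∃ r', r = r' + 1 := ⟨r - 1, by omega⟩
    refine ⟨1, ?_⟩
    rw [Nat.count_succ', Nat.count_iff_forall_not.mpr, if_pos]
    · exact Or.inr (Nat.mod_eq_of_lt (by omega))
    · exact fun m hm => hnone _ (by omega) (by omega)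
  · rw [hc]
    refine ⟨0, le_antisymm (hle2 1 one_pos (by omega) 0) ?_⟩
    rw [hc] at hWr
    refine le_trans (le_of_eq ?_) (Nat.count_monotone _ hWr)
    have h1 : 1 % K = 1 := Nat.mod_eq_of_lt (by omega)
    simp [Nat.count_succ, IsPair, h1]

theorem mod_add_sub_eq {K r p : ℕ} (hr : r < K) (hp : p < K) :
    (r + (K - p)) % K = if p ≤ r then r - p else r + (K - p) := by
  split_ifs with h
  · rw [show r + (K - p) = (r - p) + K by omega, Nat.add_mod_right, Nat.mod_eq_of_lt (by omega)]
  · exact Nat.mod_eq_of_lt (by omega)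

theorem exists_iff_isPair_add {k : ℕ} (hk : 1 ≤ k) {Q : ℕ → Prop} [DecidablePred Q]
    (hQ : ∀ m n, ∃ c, Nat.count (fun j => Q (m + j)) n =
      Nat.count (fun j => IsPair (2 * k + 1) 1 (c + j)) n) :
    ∃ d, 0 < d ∧ d ≤ k ∧ ∃ c, ∀ m, Q m ↔ IsPair (2 * k + 1) d (m + c) := by
  set K := 2 * k + 1 with hK
  have hcount : ∀ m, Nat.count (fun j => Q (m + j)) K = 2 := by
    intro m
    obtain ⟨c, hc⟩ := hQ m K
    rw [hc, count_isPair_period one_pos (by omega)]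
  have hper : Function.Periodic Q K := by
    intro m
    have := count_add_right_succ Q m K
    rw [hcount, hcount] at this
    by_cases h1 : Q m <;> by_cases h2 : Q (m + K) <;> simp_all
  have h0 := hcount 0
  simp only [Nat.zero_add] at h0
  rw [Nat.count_eq_card_filter_range, Finset.card_eq_two] at h0
  obtain ⟨p, q, hpq, hS⟩ : ∃ p q, p < q ∧ {x ∈ Finset.range K | Q x} = {p, q} := by
    obtain ⟨p, q, hne, hS⟩ := h0
    rcases hne.lt_or_gt with h | h
    · exact ⟨p, q, h, hS⟩
    · exact ⟨q, p, h, by rw [hS, Finset.pair_comm]⟩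
  have hmem : ∀ j < K, (Q j ↔ j = p ∨ j = q) := by
    intro j hj
    have : j ∈ ({x ∈ Finset.range K | Q x} : Finset ℕ) ↔ j ∈ ({p, q} : Finset ℕ) := by rw [hS]
    simpa [hj] using this
  have hqK : q < K := by
    have : q ∈ ({x ∈ Finset.range K | Q x} : Finset ℕ) := by rw [hS]; simp
    simpa using (Finset.mem_filter.mp this).1
  have hmod : ∀ m, Q m ↔ m % K = p ∨ m % K = q := by
    intro m
    rw [← hmem _ (Nat.mod_lt _ (by omega)), hper.map_mod_nat]
  -- Of the cyclic distances q - p and K - (q - p) one is at most k; the shift moves the pair's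
  -- starting point, p or q accordingly, to residue 0.
  by_cases hd : q - p ≤ k
  · refine ⟨q - p, by omega, hd, K - p, fun m => ?_⟩
    rw [hmod, IsPair, ← Nat.mod_add_mod]
    have hr : m % K < K := Nat.mod_lt _ (by omega)
    rw [mod_add_sub_eq hr (by omega)]
    split_ifs <;> omega
  · refine ⟨K - (q - p), by omega, by omega, K - q, fun m => ?_⟩
    rw [hmod, IsPair, ← Nat.mod_add_mod]
    have hr : m % K < K := Nat.mod_lt _ (by omega)
    rw [mod_add_sub_eq hr hqK]
    split_ifs <;> omega

/-- The periodic word over `{0, 1}` with ones at the positions congruent to `0` or `d` modulo `K`,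
shifted by `c`. -/
def pairWord (K d c : ℕ) : ℕ → Fin 3 := fun m => if IsPair K d (m + c) then 1 else 0

theorem pairWord_ne_two (K d c m : ℕ) : pairWord K d c m ≠ 2 := by
  unfold pairWord
  split_ifs <;> decide

theorem pairWord_eq_one_iff {K d c m : ℕ} : pairWord K d c m = 1 ↔ IsPair K d (m + c) := by
  unfold pairWord
  split_ifs with h <;> simp [h]

theorem count_pairWord (K d c m n : ℕ) :
    Nat.count (fun j => pairWord K d c (m + j) = 1) n =
      Nat.count (fun j => IsPair K d (m + c + j)) n := by
  simp only [pairWord_eq_one_iff, Nat.add_right_comm m _ c]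

/-- Two words with the same irrational slope share all factors, at positions where the counts of
zeros differ by a prescribed residue. -/
theorem HasSlope.exists_window {t t' : ℕ → Fin 2} {β : ℝ} (hβ : Irrational β)
    (h : HasSlope t β) (h' : HasSlope t' β) {K : ℕ} (hK : 0 < K) (c c' i n : ℕ) :
    ∃ i', (∀ j < n, t' (i' + j) = t (i + j)) ∧
      (∀ j ≤ n, zeros t' (i' + j) - zeros t' i' = zeros t (i + j) - zeros t i) ∧
      ∀ j ≤ n, (zeros t' (i' + j) + c') % K = (zeros t (i + j) + c) % K := by
  obtain ⟨i', m, hi⟩ := h.exists_zeros_eq hβ h' hK ((c : ℤ) - c') i n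
  have h0 := hi 0 (Nat.zero_le _)
  simp only [Nat.add_zero] at h0
  refine ⟨i', fun j hj => ?_, fun j hj => ?_, fun j hj => ?_⟩
  · have h1 := hi j hj.le
    have h2 := hi (j + 1) hj
    rw [← Nat.add_assoc, ← Nat.add_assoc, zeros_succ, zeros_succ] at h2
    by_cases ha : t' (i' + j) = 0 <;> by_cases hb : t (i + j) = 0
    · rw [ha, hb]
    · simp only [ha, hb, if_true, if_false] at h2
      omega
    · simp only [ha, hb, if_true, if_false] at h2
      omega
    · omega
  · have h1 := hi j hj
    omega
  · have h1 := hi j hj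
    have h2 : ((zeros t' (i' + j) + c' : ℕ) : ℤ) % K = ((zeros t (i + j) + c : ℕ) : ℤ) % K := by
      rw [← Int.add_mul_emod_self_right ((zeros t (i + j) + c : ℕ) : ℤ) m K]
      congr 1
      push_cast
      omega
    exact_mod_cast h2

/-! ### Which filled words lie in the closure -/

theorem language_fillZeros_subset {t t' : ℕ → Fin 2} {β : ℝ} (hβ : Irrational β)
    (h : HasSlope t β) (h' : HasSlope t' β) {K : ℕ} (hK : 0 < K) (d c c' : ℕ) :
    language (fillZeros t (pairWord K d c)) ⊆ language (fillZeros t' (pairWord K d c')) := by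
  rintro _ ⟨i, n, rfl⟩
  obtain ⟨i', h1, -, h2⟩ := h.exists_window hβ h' hK c c' i n
  refine ⟨i', n, block_eq_block_iff.mpr fun j hj => ?_⟩
  have h3 : pairWord K d c (zeros t (i + j)) = pairWord K d c' (zeros t' (i' + j)) :=
    if_congr (by rw [IsPair, IsPair, h2 j hj.le]) rfl rfl
  simp only [fillZeros, h1 j hj, h3]

theorem mem_abelianClosure_of_language_subset {α : Type*} [DecidableEq α] {x y y' : ℕ → α}
    (h : language y ⊆ language y') (hy' : y' ∈ abelianClosure x) : y ∈ abelianClosure x :=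
  fun u hu => hy' u (h hu)

theorem fillZeros_pairWord_mem_abelianClosure {t : ℕ → Fin 2} {β : ℝ} (hβ : Irrational β)
    (h : HasSlope t β) {k d : ℕ} (hd : 0 < d) (hdk : d ≤ k) (c : ℕ) :
    fillZeros t (pairWord (2 * k + 1) d 0) ∈
      abelianClosure (fillZeros t (pairWord (2 * k + 1) 1 c)) := by
  rw [fillZeros_mem_abelianClosure_iff (pairWord_ne_two _ _ _) (pairWord_ne_two _ _ _)]
  intro i n
  obtain ⟨e, he⟩ := exists_count_isPair_one_eq hd hdk (zeros t i + 0) (zeros t (i + n) - zeros t i)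
  obtain ⟨j, -, h2, h3⟩ := h.exists_window hβ h (show 0 < 2 * k + 1 by omega)
    -- As 2k ≡ -1 modulo K, this offset is a natural number standing for `e - zeros t i`; the window
    -- found thus starts at phase e.
    (e + 2 * k * zeros t i) c i n
  have h4 := h3 0 (Nat.zero_le _)
  refine ⟨j, (h2 n le_rfl).symm, ?_⟩
  rw [h2 n le_rfl, count_pairWord, count_pairWord, ← he]
  simp only [Nat.add_zero] at h4
  rw [show zeros t i + (e + 2 * k * zeros t i) = e + (2 * k + 1) * zeros t i by ring,
    Nat.add_mul_mod_self_left] at h4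
  congr 1
  funext a
  simp only [IsPair, Nat.add_mod _ a, h4]

theorem hasSlope_support_of_mem_abelianClosure {s : ℕ → Fin 2} {w y : ℕ → Fin 3} {β : ℝ}
    (hw : ∀ m, w m ≠ 2) (hs : HasSlope s β) (hy : y ∈ abelianClosure (fillZeros s w)) :
    HasSlope (support y) β := by
  intro i n
  obtain ⟨j, hj⟩ := mem_abelianClosure_iff.mp hy i n
  have h2 := count_fillZeros_two s hw j n
  have h3 : Nat.count (fun m => y (i + m) = 2) n +
      (zeros (support y) (i + n) - zeros (support y) i) = n := by
    have h4 : zeros (support y) (i + n) - zeros (support y) i =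
        Nat.count (fun m => support y (i + m) = 0) n := by
      rw [zeros, Nat.count_add, zeros, Nat.add_sub_cancel_left]
    rw [h4]
    clear h4 h2 hj
    induction n with
    | zero => simp
    | succ n ih =>
      rw [Nat.count_succ, Nat.count_succ]
      by_cases h : y (i + n) = 2 <;> simp [support, h] at ih ⊢ <;> omega
  have h5 := zeros_mono (support y) (Nat.le_add_right i n)
  have h6 := zeros_mono s (Nat.le_add_right j n)
  have h7 : (zeros (support y) (i + n) : ℝ) - zeros (support y) i =
      zeros s (j + n) - zeros s j := by
    rw [← Nat.cast_sub h5, ← Nat.cast_sub h6]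
    congr 1
    have := hj 2
    omega
  rw [h7]
  exact hs j n

theorem exists_eq_fillZeros_pairWord {s : ℕ → Fin 2} {y : ℕ → Fin 3} {β : ℝ} (hβ : Irrational β)
    (hs : HasSlope s β) {k c : ℕ} (hk : 1 ≤ k)
    (hy : y ∈ abelianClosure (fillZeros s (pairWord (2 * k + 1) 1 c))) :
    HasSlope (support y) β ∧ ∃ d, 0 < d ∧ d ≤ k ∧ ∃ c',
      y = fillZeros (support y) (pairWord (2 * k + 1) d c') := by
  have hslope := hasSlope_support_of_mem_abelianClosure (pairWord_ne_two _ _ _) hs hy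
  refine ⟨hslope, ?_⟩
  set t := support y with ht
  set z : ℕ → Fin 3 := fun m => y (Nat.nth (fun i => t i = 0) m) with hz
  have hinf := hslope.infinite_zeros hβ
  have hyz : fillZeros t z = y := fillZeros_support y
  have hz2 : ∀ m, z m ≠ 2 := by
    intro m hm
    have h0 : t (Nat.nth (fun i => t i = 0) m) = 0 := Nat.nth_mem_of_infinite hinf m
    rw [ht, support, if_pos hm] at h0
    simp at h0
  have hzeros : ∀ m, zeros t (Nat.nth (fun i => t i = 0) m) = m :=
    Nat.count_nth_of_infinite hinf
  rw [← hyz, fillZeros_mem_abelianClosure_iff hz2 (pairWord_ne_two _ _ _)] at hy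
  -- The factor of y from its m-th to just before its (m + n)-th zero contains exactly the n filling
  -- letters from m on, so every window of z gets tested.
  obtain ⟨d, hd, hdk, c', hc'⟩ := exists_iff_isPair_add hk (Q := fun m => z m = 1) (by
    intro m n
    obtain ⟨r, hr⟩ := Nat.exists_eq_add_of_le
      (Nat.nth_monotone hinf (Nat.le_add_right m n))
    obtain ⟨j, hj1, hj2⟩ := hy (Nat.nth (fun i => t i = 0) m) r
    rw [← hj1, ← hr, hzeros, hzeros, Nat.add_sub_cancel_left, count_pairWord] at hj2
    exact ⟨_, hj2⟩)
  refine ⟨d, hd, hdk, c', ?_⟩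
  rw [← hyz]
  congr 1
  funext m
  unfold pairWord
  split_ifs with h
  · exact (hc' m).mpr h
  · have h1 : z m ≠ 1 := fun h1 => h ((hc' m).mp h1)
    have h2 := hz2 m
    revert h1 h2
    generalize z m = a
    revert a
    decide

/-- The prefix ending at zero number d shows two ones d zeros apart. In the other word this distance
is 0, d' or -d' modulo K, and d + d' < K leaves only d = d'. -/
theorem eq_of_language_subset {t : ℕ → Fin 2} {β : ℝ} (hβ : Irrational β) (h : HasSlope t β)
    {k d d' : ℕ} (hd : 0 < d) (hdk : d ≤ k) (hd' : 0 < d') (hdk' : d' ≤ k)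
    (hL : language (fillZeros t (pairWord (2 * k + 1) d 0)) ⊆
      language (fillZeros t (pairWord (2 * k + 1) d' 0))) : d = d' := by
  set K := 2 * k + 1 with hK
  have hinf := h.infinite_zeros hβ
  set p : ℕ → ℕ := Nat.nth (fun i => t i = 0) with hp
  have hzeros : ∀ m, zeros t (p m) = m := Nat.count_nth_of_infinite hinf
  have hp0 : ∀ m, t (p m) = 0 := Nat.nth_mem_of_infinite hinf
  obtain ⟨i, n, hblock⟩ := hL ⟨0, p d + 1, rfl⟩
  obtain rfl : p d + 1 = n := by simpa [length_block] using congrArg List.length hblock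
  rw [block_eq_block_iff] at hblock
  have hle : p 0 ≤ p d := Nat.nth_monotone hinf (Nat.zero_le _)
  have ht : ∀ m ≤ p d, t m = t (i + m) := by
    intro m hm
    have h1 := congrArg (fun a : Fin 3 => if a = 2 then (1 : Fin 2) else 0)
      (hblock m (by omega))
    simp only [Nat.zero_add] at h1
    have h2 := congrFun (support_fillZeros t (pairWord_ne_two K d 0)) m
    have h3 := congrFun (support_fillZeros t (pairWord_ne_two K d' 0)) (i + m)
    rw [← h2, ← h3]
    exact h1
  have hZ : ∀ m ≤ p d, zeros t (i + m) = zeros t i + zeros t m := by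
    intro m hm
    induction m with
    | zero => simp [zeros]
    | succ m ih =>
      rw [← Nat.add_assoc, zeros_succ, zeros_succ, ih (by omega), ht m (by omega)]
      ring
  have key : ∀ m, m ≤ d → IsPair K d m → IsPair K d' (zeros t i + m) := by
    intro m hm hpair
    have hmd : p m ≤ p d := Nat.nth_monotone hinf hm
    have h1 := hblock (p m) (by omega)
    rw [Nat.zero_add] at h1
    simp only [fillZeros, ← ht _ hmd, hp0, if_true, hZ _ hmd, hzeros] at h1
    rw [pairWord_eq_one_iff.mpr (by simpa using hpair)] at h1
    simpa using pairWord_eq_one_iff.mp h1.symm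
  have k0 := key 0 (Nat.zero_le _) (Or.inl (Nat.zero_mod K))
  have kd := key d le_rfl (Or.inr (Nat.mod_eq_of_lt (by omega)))
  rw [IsPair, ← Nat.mod_add_mod] at kd
  rw [IsPair, Nat.add_zero] at k0
  rcases k0 with h0 | h0
  · rw [h0, Nat.zero_add, Nat.mod_eq_of_lt (by omega)] at kd
    omega
  · rw [h0, Nat.mod_eq_of_lt (by omega)] at kd
    omega

/-! ### Subshifts given by a language -/

theorem block_shift {α : Type*} (y : ℕ → α) (i n : ℕ) : block (shift y) i n = block y (i + 1) n :=
  block_eq_block_iff.mpr fun m _ => by simp [shift, Nat.add_right_comm]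

theorem block_iterate_shift {α : Type*} (y : ℕ → α) (i n : ℕ) :
    block (shift^[i] y) 0 n = block y i n := by
  induction i generalizing y with
  | zero => rfl
  | succ i ih => rw [Function.iterate_succ_apply, ih, block_shift]

theorem isClosed_setOf_language_subset {α : Type*} [TopologicalSpace α] [DiscreteTopology α]
    (L : Set (List α)) : IsClosed {y : ℕ → α | language y ⊆ L} := by
  have : {y : ℕ → α | language y ⊆ L} = ⋂ i : ℕ, ⋂ n : ℕ, {y | block y i n ∈ L} := by
    ext y
    simp only [Set.mem_ofPred_eq, Set.mem_iInter]
    exact ⟨fun h i n => h ⟨i, n, rfl⟩, by rintro h _ ⟨i, n, rfl⟩; exact h i n⟩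
  rw [this]
  refine isClosed_iInter fun i => isClosed_iInter fun n => ?_
  have hc : Continuous fun y : ℕ → α => fun j : Fin n => y (i + j) := by fun_prop
  exact (isClosed_discrete {f : Fin n → α | List.ofFn f ∈ L}).preimage hc

theorem isSubshift_setOf_language_subset {α : Type*} [TopologicalSpace α] [DiscreteTopology α]
    (x : ℕ → α) : IsSubshift {y : ℕ → α | language y ⊆ language x} := by
  refine ⟨⟨x, Set.Subset.rfl⟩, isClosed_setOf_language_subset _, ?_⟩
  rintro _ ⟨y, hy, rfl⟩ _ ⟨i, n, rfl⟩
  exact hy ⟨i + 1, n, block_shift y i n⟩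

/-- Each prefix of x is a prefix of some shift of y, so x is a limit of shifts of y. -/
theorem IsSubshift.mem_of_language_subset {α : Type*} [TopologicalSpace α] [DiscreteTopology α]
    {Y : Set (ℕ → α)} (hY : IsSubshift Y) {y x : ℕ → α} (hy : y ∈ Y)
    (h : language x ⊆ language y) : x ∈ Y := by
  have hiter : ∀ i, shift^[i] y ∈ Y := by
    intro i
    induction i with
    | zero => exact hy
    | succ i ih =>
      rw [Function.iterate_succ_apply']
      exact hY.2.2 ⟨_, ih, rfl⟩
  have hex : ∀ n, ∃ i, block x 0 n = block (shift^[i] y) 0 n := by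
    intro n
    obtain ⟨i, n', hi⟩ := h ⟨0, n, rfl⟩
    obtain rfl : n = n' := by simpa [length_block] using congrArg List.length hi
    exact ⟨i, by rw [hi, block_iterate_shift]⟩
  choose i hi using hex
  refine hY.2.1.mem_of_tendsto (f := fun n => shift^[i n] y) (b := Filter.atTop) ?_
    (Filter.Eventually.of_forall fun n => hiter (i n))
  rw [tendsto_pi_nhds]
  intro m
  refine tendsto_const_nhds.congr' ?_
  filter_upwards [Filter.eventually_gt_atTop m] with n hn
  simpa using block_eq_block_iff.mp (hi n) m hn

theorem isMinimalSubshift_of_language {α : Type*} [TopologicalSpace α] [DiscreteTopology α]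
    {x : ℕ → α} (hx : ∀ y : ℕ → α, language y ⊆ language x → language x ⊆ language y) :
    IsMinimalSubshift {y : ℕ → α | language y ⊆ language x} := by
  refine ⟨isSubshift_setOf_language_subset x, fun Y hY hYX => hYX.antisymm fun y hy => ?_⟩
  obtain ⟨y', hy'⟩ := hY.1
  exact hY.mem_of_language_subset hy' (hy.trans (hx y' (hYX hy')))

/-! ### Aperiodicity and the decomposition of the closure -/

theorem HasSlope.isAperiodic {t : ℕ → Fin 2} {β : ℝ} (hβ : Irrational β) (h : HasSlope t β) :
    IsAperiodic t := by
  rintro ⟨N, p, hp, hper⟩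
  have hZ : ∀ n, zeros t (N + p + n) = zeros t (N + n) + (zeros t (N + p) - zeros t N) := by
    intro n
    induction n with
    | zero => have := zeros_mono t (Nat.le_add_right N p); simp; omega
    | succ n ih =>
      have h1 := hper (N + n) (by omega)
      rw [← Nat.add_assoc, ← Nat.add_assoc, zeros_succ, zeros_succ, ih,
        show N + p + n = N + n + p by ring, h1]
      ring
  set q := zeros t (N + p) - zeros t N with hq
  have hZq : ∀ m : ℕ, zeros t (N + m * p) = zeros t N + m * q := by
    intro m
    induction m with
    | zero => simp
    | succ m ih =>
      rw [show N + (m + 1) * p = N + p + m * p by ring, hZ, ih]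
      ring
  -- With q zeros per period p, the deviation from slope β grows by this nonzero amount each period,
  -- against the bound 1.
  have hne : (p : ℝ) * β - q ≠ 0 := by
    have := (hβ.natCast_mul hp.ne').ne_nat q
    exact sub_ne_zero.mpr this
  obtain ⟨m, hm⟩ := Archimedean.arch (2 : ℝ) (abs_pos.mpr hne)
  rw [nsmul_eq_mul] at hm
  have h1 := h N (m * p)
  rw [hZq] at h1
  push_cast at h1
  rw [show (zeros t N : ℝ) + m * q - zeros t N - m * p * β = -(m * (p * β - q)) by ring,
    abs_neg, abs_mul, Nat.abs_cast] at h1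
  linarith

theorem isAperiodic_fillZeros {t : ℕ → Fin 2} (h : IsAperiodic t) {z : ℕ → Fin 3}
    (hz : ∀ m, z m ≠ 2) : IsAperiodic (fillZeros t z) := by
  rintro ⟨N, p, hp, hper⟩
  refine h ⟨N, p, hp, fun n hn => ?_⟩
  rw [← support_fillZeros t hz]
  simp only [support, hper n hn]

theorem isUnionOfDistinctMinimalSubshifts_fillZeros {t : ℕ → Fin 2} {β : ℝ} (hβ : Irrational β)
    (h : HasSlope t β) {k : ℕ} (hk : 1 ≤ k) (c : ℕ) :
    IsUnionOfDistinctMinimalSubshifts k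
      (abelianClosure (fillZeros t (pairWord (2 * k + 1) 1 c))) := by
  set K := 2 * k + 1 with hK
  have hKpos : 0 < K := by omega
  set x : ℕ → ℕ → Fin 3 := fun d => fillZeros t (pairWord K d 0) with hx
  have hmem : ∀ d, 0 < d → d ≤ k → ∀ y, language y ⊆ language (x d) →
      y ∈ abelianClosure (fillZeros t (pairWord K 1 c)) := fun d hd hdk y hy =>
    mem_abelianClosure_of_language_subset hy
      (fillZeros_pairWord_mem_abelianClosure hβ h hd hdk c)
  have hlang : ∀ y ∈ abelianClosure (fillZeros t (pairWord K 1 c)),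
      ∃ d, 0 < d ∧ d ≤ k ∧ language y = language (x d) := by
    intro y hy
    obtain ⟨hs, d, hd, hdk, c', hc'⟩ := exists_eq_fillZeros_pairWord hβ h hk hy
    refine ⟨d, hd, hdk, ?_⟩
    rw [hc']
    exact (language_fillZeros_subset hβ hs h hKpos d c' 0).antisymm
      (language_fillZeros_subset hβ h hs hKpos d 0 c')
  refine ⟨fun e : Fin k => {y | language y ⊆ language (x (e + 1))}, ?_, ?_, ?_⟩
  · intro e e' hee
    have h1 : x (e + 1) ∈ {y | language y ⊆ language (x (e' + 1))} := by
      rw [← show _ = {y | language y ⊆ language (x (e' + 1))} from hee]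
      exact Set.Subset.rfl
    have := eq_of_language_subset hβ h (Nat.succ_pos _) e.2 (Nat.succ_pos _) e'.2 h1
    exact Fin.ext (by omega)
  · intro e
    refine isMinimalSubshift_of_language fun y hy => ?_
    obtain ⟨d, hd, hdk, hyd⟩ := hlang y (hmem _ (Nat.succ_pos _) e.2 y hy)
    obtain rfl : d = e + 1 :=
      eq_of_language_subset hβ h hd hdk (Nat.succ_pos _) e.2 (hyd.symm.subset.trans hy)
    exact hyd.symm.subset
  · ext y
    simp only [Set.mem_iUnion, Set.mem_ofPred_eq]
    constructor
    · intro hy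
      obtain ⟨d, hd, hdk, hyd⟩ := hlang y hy
      refine ⟨⟨d - 1, by omega⟩, ?_⟩
      simp only [Nat.sub_add_cancel hd]
      exact hyd.subset
    · rintro ⟨e, he⟩
      exact hmem _ (Nat.succ_pos _) e.2 y he

/-! ### Balanced words -/

/-- The numbers of zeros in two factors of the same length differ by at most one. -/
def IsBalanced (t : ℕ → Fin 2) : Prop :=
  ∀ n i j, zeros t (i + n) + zeros t j ≤ zeros t (j + n) + zeros t i + 1

/-- Cut the prefix of length q * n into q factors of length n and compare each with the one at i. -/
theorem IsBalanced.mul_le {t : ℕ → Fin 2} (h : IsBalanced t) (i n q : ℕ) :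
    q * ((zeros t (i + n) : ℝ) - zeros t i - 1) ≤ zeros t (q * n) ∧
      (zeros t (q * n) : ℝ) ≤ q * ((zeros t (i + n) : ℝ) - zeros t i + 1) := by
  induction q with
  | zero => simp [zeros]
  | succ q ih =>
    have h1 : (zeros t (i + n) : ℝ) + zeros t (q * n) ≤ zeros t (q * n + n) + zeros t i + 1 := by
      exact_mod_cast h n i (q * n)
    have h2 : (zeros t (q * n + n) : ℝ) + zeros t i ≤ zeros t (i + n) + zeros t (q * n) + 1 := by
      exact_mod_cast h n (q * n) i
    rw [Nat.succ_mul]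
    push_cast
    constructor <;> linarith [ih.1, ih.2]

theorem IsBalanced.exists_hasSlope {t : ℕ → Fin 2} (h : IsBalanced t) : ∃ β, HasSlope t β := by
  set f : ℕ → ℕ → ℝ := fun i n => (zeros t (i + n) : ℝ) - zeros t i with hf
  -- Both quotients are compared through the prefix of length (n + 1)(m + 1); β can then be any
  -- number separating the two families.
  have key : ∀ i n j m, (f i (n + 1) - 1) / (n + 1 : ℕ) ≤ (f j (m + 1) + 1) / (m + 1 : ℕ) := by
    intro i n j m
    rw [div_le_div_iff₀ (by positivity) (by positivity)]
    have h1 := (h.mul_le i (n + 1) (m + 1)).1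
    have h2 := (h.mul_le j (m + 1) (n + 1)).2
    rw [Nat.mul_comm] at h2
    linarith
  refine ⟨⨆ p : ℕ × ℕ, (f p.1 (p.2 + 1) - 1) / (p.2 + 1 : ℕ), fun i n => ?_⟩
  rcases n with - | n
  · simp
  have hb : BddAbove (Set.range fun p : ℕ × ℕ => (f p.1 (p.2 + 1) - 1) / (p.2 + 1 : ℕ)) :=
    ⟨_, by rintro _ ⟨p, rfl⟩; exact key p.1 p.2 0 0⟩
  have h1 := le_ciSup hb (i, n)
  have h2 := ciSup_le fun p : ℕ × ℕ => key p.1 p.2 i n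
  have hpos : (0 : ℝ) < (n + 1 : ℕ) := by positivity
  rw [div_le_iff₀ hpos] at h1
  rw [le_div_iff₀ hpos] at h2
  simp only [hf] at h1 h2 ⊢
  rw [abs_le]
  constructor <;> linarith

/-- Along a residue class modulo q, D never decreases and each rise is at least q, while the total
rise is at most q. So each class has at most one rise. -/
theorem exists_forall_ge_add_eq {D : ℕ → ℤ} {q : ℕ} (hq : 0 < q) (hmono : ∀ i, D i ≤ D (i + q))
    (hbd : ∀ i j, i ≤ j → D j - D i ≤ q) (hgap : ∀ i, D (i + q) ≠ D i → D i + q ≤ D (i + q)) :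
    ∃ N, ∀ i, N ≤ i → D (i + q) = D i := by
  have hmono' : ∀ i m, D i ≤ D (i + m * q) := by
    intro i m
    induction m with
    | zero => simp
    | succ m ih =>
      rw [Nat.succ_mul, ← Nat.add_assoc]
      exact ih.trans (hmono _)
  have hlt : ∀ i j, i < j → i % q = j % q → D (i + q) ≠ D i → D (j + q) = D j := by
    intro i j hij hmod hi
    by_contra hj
    obtain ⟨m, hm⟩ := (Nat.modEq_iff_dvd' hij.le).mp hmod
    obtain ⟨m, rfl⟩ : ∃ m', m = m' + 1 := by
      refine ⟨m - 1, ?_⟩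
      have : m ≠ 0 := by rintro rfl; omega
      omega
    have hj' : j = i + q + m * q := by
      rw [Nat.mul_add, Nat.mul_comm q m] at hm
      omega
    have h1 := hmono' (i + q) m
    rw [← hj'] at h1
    have h2 := hgap i hi
    have h3 := hgap j hj
    have h4 := hbd i (j + q) (by omega)
    omega
  have hfin : {i | D (i + q) ≠ D i}.Finite := by
    refine Set.Finite.of_injOn (f := fun i => i % q) (t := Set.Iio q)
      (fun i _ => Nat.mod_lt _ hq) ?_ (Set.finite_Iio q)
    intro i hi j hj hij
    rcases lt_trichotomy i j with h | h | h
    · exact absurd (hlt i j h hij hi) hj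
    · exact h
    · exact absurd (hlt j i h hij.symm hj) hi
  obtain ⟨N, hN⟩ := hfin.bddAbove
  refine ⟨N + 1, fun i hi => ?_⟩
  by_contra hne
  have := hN hne
  omega

theorem IsBalanced.irrational_of_isAperiodic {t : ℕ → Fin 2} (h : IsBalanced t)
    (hap : IsAperiodic t) {β : ℝ} (hβ : HasSlope t β) : Irrational β := by
  rintro ⟨r, rfl⟩
  set q := r.den with hq
  have hqpos : 0 < q := r.den_pos
  set D : ℕ → ℤ := fun i => q * zeros t i - i * r.num with hD
  have hstep : ∀ i, D (i + q) - D i = q * ((zeros t (i + q) : ℤ) - zeros t i - r.num) := by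
    intro i
    simp only [hD]
    push_cast
    ring
  have hbd : ∀ i j, i ≤ j → |D j - D i| ≤ q := by
    intro i j hij
    obtain ⟨n, rfl⟩ := Nat.exists_eq_add_of_le hij
    have h1 := hβ i n
    have hq' : (0 : ℝ) < q := by exact_mod_cast hqpos
    have hr : (q : ℝ) * (r : ℝ) = r.num := by exact_mod_cast Rat.den_mul_eq_num r
    have h2 : ((|D (i + n) - D i| : ℤ) : ℝ) =
        q * |(zeros t (i + n) : ℝ) - zeros t i - n * (r : ℝ)| := by
      nth_rewrite 1 [← abs_of_pos hq']
      rw [Int.cast_abs, ← abs_mul]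
      congr 1
      simp only [hD]
      push_cast
      rw [← hr]
      ring
    have h3 : ((|D (i + n) - D i| : ℤ) : ℝ) ≤ (q : ℤ) := by
      rw [h2]
      push_cast
      nlinarith
    exact_mod_cast h3
  have hper : ∃ N, ∀ i, N ≤ i → D (i + q) = D i := by
    -- By balance, the zero counts of factors of length q cannot lie both above and below `r.num`,
    -- so D or -D is monotone along steps of q.
    by_cases hpos : ∀ i, 0 ≤ (zeros t (i + q) : ℤ) - zeros t i - r.num
    · refine exists_forall_ge_add_eq hqpos (fun i => ?_)
        (fun i j hij => (abs_le.mp (hbd i j hij)).2) fun i hi => ?_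
      · have := hstep i
        have := hpos i
        nlinarith
      · have h1 := hstep i
        have h2 : (zeros t (i + q) : ℤ) - zeros t i - r.num ≠ 0 := by
          intro h0
          rw [h0] at h1
          apply hi
          linarith
        have h3 := hpos i
        have h4 : 1 ≤ (zeros t (i + q) : ℤ) - zeros t i - r.num := by omega
        nlinarith
    · push Not at hpos
      obtain ⟨i₀, hi₀⟩ := hpos
      have hneg : ∀ i, (zeros t (i + q) : ℤ) - zeros t i - r.num ≤ 0 := by
        intro i
        have := h q i i₀
        omega
      obtain ⟨N, hN⟩ := exists_forall_ge_add_eq (D := fun i => -D i) hqpos (fun i => by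
          have := hstep i
          have := hneg i
          nlinarith)
        (fun i j hij => by have := (abs_le.mp (hbd i j hij)).1; linarith) (fun i hi => by
          have h1 := hstep i
          have h2 : (zeros t (i + q) : ℤ) - zeros t i - r.num ≠ 0 := by
            intro h0
            rw [h0] at h1
            apply hi
            linarith
          have h3 := hneg i
          have h4 : (zeros t (i + q) : ℤ) - zeros t i - r.num ≤ -1 := by omega
          nlinarith)
      exact ⟨N, fun i hi => neg_inj.mp (hN i hi)⟩
  obtain ⟨N, hN⟩ := hper
  refine hap ⟨N, q, hqpos, fun n hn => ?_⟩
  have hz : ∀ i, N ≤ i → (zeros t (i + q) : ℤ) - zeros t i - r.num = 0 := by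
    intro i hi
    have h1 := hstep i
    rw [hN i hi, sub_self, eq_comm] at h1
    rcases mul_eq_zero.mp h1 with h0 | h0
    · omega
    · exact h0
  have h1 := hz n hn
  have h2 := hz (n + 1) (by omega)
  rw [Nat.add_right_comm, zeros_succ, zeros_succ] at h2
  by_cases ha : t (n + q) = 0 <;> by_cases hb : t n = 0 <;> simp [ha, hb] at h2 ⊢ <;> omega

/-! ### A word of given slope -/

/-- The word is chosen so that its first i letters contain ⌊iβ⌋ zeros. -/
theorem exists_hasSlope {β : ℝ} (h0 : 0 < β) (h1 : β < 1) : ∃ t, HasSlope t β := by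
  set t : ℕ → Fin 2 := fun i => if ⌊((i + 1 : ℕ) : ℝ) * β⌋₊ = ⌊(i : ℝ) * β⌋₊ + 1 then 0 else 1
    with ht
  have hz : ∀ i : ℕ, zeros t i = ⌊(i : ℝ) * β⌋₊ := by
    intro i
    induction i with
    | zero => simp [zeros]
    | succ i ih =>
      rw [zeros_succ, ih]
      have h2 : ⌊(i : ℝ) * β⌋₊ ≤ ⌊((i + 1 : ℕ) : ℝ) * β⌋₊ := by
        apply Nat.floor_le_floor
        push_cast
        nlinarith
      have h3 : ⌊((i + 1 : ℕ) : ℝ) * β⌋₊ ≤ ⌊(i : ℝ) * β⌋₊ + 1 := by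
        rw [← Nat.floor_add_one (by positivity)]
        apply Nat.floor_le_floor
        push_cast
        nlinarith
      by_cases h : ⌊((i + 1 : ℕ) : ℝ) * β⌋₊ = ⌊(i : ℝ) * β⌋₊ + 1
      · rw [h, if_pos (by rw [ht]; exact if_pos h)]
      · have h4 : t i ≠ 0 := by
          rw [show t i = 1 from if_neg h]
          decide
        rw [if_neg h4]
        omega
  refine ⟨t, fun i n => ?_⟩
  rw [hz, hz]
  have a1 := Nat.floor_le (show 0 ≤ (i : ℝ) * β by positivity)
  have a2 := Nat.lt_floor_add_one ((i : ℝ) * β)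
  have a3 := Nat.floor_le (show 0 ≤ ((i + n : ℕ) : ℝ) * β by positivity)
  have a4 := Nat.lt_floor_add_one (((i + n : ℕ) : ℝ) * β)
  have a5 : ((i + n : ℕ) : ℝ) * β = i * β + n * β := by push_cast; ring
  rw [a5] at a3 a4 ⊢
  rw [abs_le]
  constructor <;> linarith

/-! ### Sturmian words are balanced -/

/-- The factor of length `m` at position `p` is right special: it also occurs followed by another
letter. -/
def IsRightSpecialAt (t : ℕ → Fin 2) (m p : ℕ) : Prop :=
  ∃ q, block t q m = block t p m ∧ t (q + m) ≠ t (p + m)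

theorem IsRightSpecialAt.of_block_eq {t : ℕ → Fin 2} {m p p' : ℕ} (h : IsRightSpecialAt t m p)
    (hb : block t p m = block t p' m) : IsRightSpecialAt t m p' := by
  obtain ⟨q, hq, hne⟩ := h
  by_cases hp : t (p + m) = t (p' + m)
  · exact ⟨q, hq.trans hb, hp ▸ hne⟩
  · exact ⟨p, hb, hp⟩

theorem IsRightSpecialAt.suffix {t : ℕ → Fin 2} {m p : ℕ} (h : IsRightSpecialAt t (m + 1) p) :
    IsRightSpecialAt t m (p + 1) := by
  obtain ⟨q, hq, hne⟩ := h
  refine ⟨q + 1, block_eq_block_iff.mpr fun a ha => ?_, ?_⟩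
  · have := block_eq_block_iff.mp hq (a + 1) (by omega)
    rwa [Nat.add_right_comm q, Nat.add_right_comm p]
  · rwa [Nat.add_right_comm q, Nat.add_right_comm p]

theorem take_block {α : Type*} (x : ℕ → α) (i m : ℕ) :
    (block x i (m + 1)).take m = block x i m := by
  have : block x i (m + 1) = block x i m ++ [x (i + m)] := by
    rw [block, List.ofFn_succ', List.concat_eq_append]
    simp [block]
  rw [this, List.take_append_of_le_length (by simp [length_block]),
    List.take_of_length_le (by simp [length_block])]

theorem block_succ_eq_iff {α : Type*} {x : ℕ → α} {i j m : ℕ} :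
    block x i (m + 1) = block x j (m + 1) ↔
      block x i m = block x j m ∧ x (i + m) = x (j + m) := by
  simp only [block_eq_block_iff]
  constructor
  · exact fun h => ⟨fun a ha => h a (by omega), h m (by omega)⟩
  · rintro ⟨h1, h2⟩ a ha
    rcases Nat.lt_succ_iff_lt_or_eq.mp ha with h | rfl
    · exact h1 a h
    · exact h2

theorem block_mem_languageOfLength {α : Type*} (x : ℕ → α) (i m : ℕ) :
    block x i m ∈ languageOfLength m x :=
  ⟨⟨i, m, rfl⟩, length_block x i m⟩

theorem exists_eq_block_of_mem_languageOfLength {α : Type*} {x : ℕ → α} {m : ℕ} {u : List α}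
    (h : u ∈ languageOfLength m x) : ∃ i, u = block x i m := by
  obtain ⟨⟨i, n, rfl⟩, hn⟩ := h
  rw [length_block] at hn
  exact ⟨i, by rw [hn]⟩

theorem IsSturmian.finite_languageOfLength {t : ℕ → Fin 2} (h : IsSturmian t) (m : ℕ) :
    (languageOfLength m t).Finite :=
  Set.finite_of_ncard_ne_zero (by rw [h.2]; omega)

/-- With two distinct right special factors, one extension of each could be discarded and truncation
from length m + 1 to m would still be onto, from only m words. -/
theorem IsSturmian.block_eq_of_isRightSpecialAt {t : ℕ → Fin 2} (h : IsSturmian t) {m p p' : ℕ}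
    (hp : IsRightSpecialAt t m p) (hp' : IsRightSpecialAt t m p') :
    block t p m = block t p' m := by
  by_contra hne
  have hne' : block t p (m + 1) ≠ block t p' (m + 1) := fun h0 =>
    hne (block_succ_eq_iff.mp h0).1
  set S := languageOfLength (m + 1) t \ {block t p (m + 1), block t p' (m + 1)} with hS
  have hsub : languageOfLength m t ⊆ List.take m '' S := by
    intro u hu
    obtain ⟨i, rfl⟩ := exists_eq_block_of_mem_languageOfLength hu
    have hmem : ∀ j, block t j m = block t i m → block t j (m + 1) ≠ block t p (m + 1) →
        block t j (m + 1) ≠ block t p' (m + 1) → block t i m ∈ List.take m '' S := by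
      intro j hj h1 h2
      exact ⟨block t j (m + 1), ⟨block_mem_languageOfLength t j (m + 1), by simp [h1, h2]⟩,
        by rw [take_block, hj]⟩
    by_cases h1 : block t i (m + 1) = block t p (m + 1)
    · obtain ⟨q, hq, hqne⟩ := hp
      have h2 := (block_succ_eq_iff.mp h1).1
      exact hmem q (hq.trans h2.symm) (fun h3 => hqne (block_succ_eq_iff.mp h3).2)
        fun h3 => hne (hq.symm.trans (block_succ_eq_iff.mp h3).1)
    by_cases h1' : block t i (m + 1) = block t p' (m + 1)
    · obtain ⟨q, hq, hqne⟩ := hp'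
      have h2 := (block_succ_eq_iff.mp h1').1
      exact hmem q (hq.trans h2.symm)
        (fun h3 => hne ((block_succ_eq_iff.mp h3).1.symm.trans hq))
        (fun h3 => hqne (block_succ_eq_iff.mp h3).2)
    · exact hmem i rfl h1 h1'
  have hfin := h.finite_languageOfLength (m + 1)
  have h1 : (languageOfLength m t).ncard ≤ S.ncard :=
    (Set.ncard_le_ncard hsub ((hfin.subset Set.sdiff_subset).image _)).trans
      (Set.ncard_image_le (hfin.subset Set.sdiff_subset))
  have h2 : S.ncard + ({block t p (m + 1), block t p' (m + 1)} : Set (List (Fin 2))).ncard =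
      (languageOfLength (m + 1) t).ncard := by
    refine Set.ncard_sdiff_add_ncard_of_subset ?_ hfin
    rintro u (rfl | rfl) <;> exact block_mem_languageOfLength _ _ _
  rw [Set.ncard_pair hne', h.2] at h2
  rw [h.2] at h1
  omega

theorem IsSturmian.exists_isRightSpecialAt {t : ℕ → Fin 2} (h : IsSturmian t) (m : ℕ) :
    ∃ p, IsRightSpecialAt t m p := by
  by_contra hno
  push Not at hno
  have h1 : (languageOfLength (m + 1) t).ncard ≤ (languageOfLength m t).ncard := by
    refine Set.ncard_le_ncard_of_injOn (List.take m) ?_ ?_ (h.finite_languageOfLength m)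
    · intro u hu
      obtain ⟨i, rfl⟩ := exists_eq_block_of_mem_languageOfLength hu
      rw [take_block]
      exact block_mem_languageOfLength t i m
    · intro u hu v hv huv
      obtain ⟨i, rfl⟩ := exists_eq_block_of_mem_languageOfLength hu
      obtain ⟨j, rfl⟩ := exists_eq_block_of_mem_languageOfLength hv
      rw [take_block, take_block] at huv
      refine block_succ_eq_iff.mpr ⟨huv, ?_⟩
      by_contra hne
      exact hno j ⟨i, huv, hne⟩
  rw [h.2, h.2] at h1
  omega

/-- If m + 1 consecutive positions carry no right special factor, only m factors are available and
one repeats. Factors that are not right special determine the next letter, so the repetition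
propagates and t is ultimately periodic. -/
theorem IsSturmian.exists_isRightSpecialAt_add {t : ℕ → Fin 2} (h : IsSturmian t) (m b : ℕ) :
    ∃ a ≤ m, IsRightSpecialAt t m (b + a) := by
  by_contra hno
  push Not at hno
  obtain ⟨p₀, hp₀⟩ := h.exists_isRightSpecialAt m
  have hfin := h.finite_languageOfLength m
  set S := languageOfLength m t \ {block t p₀ m} with hS
  have hSfin : S.Finite := hfin.subset Set.sdiff_subset
  have hScard : hSfin.toFinset.card = m := by
    rw [← Set.ncard_eq_toFinset_card S hSfin]
    have : S.ncard + 1 = (languageOfLength m t).ncard :=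
      Set.ncard_sdiff_singleton_add_one (block_mem_languageOfLength t p₀ m) hfin
    rw [h.2] at this
    omega
  obtain ⟨a, ha, a', ha', hne, heq⟩ : ∃ a ∈ Finset.range (m + 1), ∃ a' ∈ Finset.range (m + 1),
      a ≠ a' ∧ block t (b + a) m = block t (b + a') m := by
    refine Finset.exists_ne_map_eq_of_card_lt_of_maps_to (t := hSfin.toFinset)
      (by rw [hScard, Finset.card_range]; omega) fun a ha => ?_
    simp only [Finset.coe_range, Set.mem_Iio] at ha
    simp only [Set.Finite.coe_toFinset]
    refine ⟨block_mem_languageOfLength t _ m, fun h0 => ?_⟩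
    exact hno a (by omega) (hp₀.of_block_eq (Set.mem_singleton_iff.mp h0).symm)
  obtain ⟨a, d, hd, had, heq⟩ : ∃ a d, 0 < d ∧ a + d ≤ m ∧
      block t (b + a) m = block t (b + a + d) m := by
    simp only [Finset.mem_range] at ha ha'
    rcases hne.lt_or_gt with hlt | hlt
    · exact ⟨a, a' - a, by omega, by omega, by
        rw [show b + a + (a' - a) = b + a' by omega, heq]⟩
    · exact ⟨a', a - a', by omega, by omega, by
        rw [show b + a' + (a - a') = b + a by omega, heq]⟩
  have key : ∀ x, block t (b + a + x) m = block t (b + a + d + x) m ∧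
      ¬ IsRightSpecialAt t m (b + a + x) := by
    intro x
    induction x using Nat.strong_induction_on with
    | _ x ih =>
      constructor
      · rcases x with - | x
        · exact heq
        · obtain ⟨h1, h2⟩ := ih x (by omega)
          have h3 : t (b + a + x + m) = t (b + a + d + x + m) := by
            by_contra h0
            exact h2 ⟨b + a + d + x, h1.symm, fun h4 => h0 h4.symm⟩
          have h4 := block_succ_eq_iff.mpr ⟨h1, h3⟩
          refine block_eq_block_iff.mpr fun c hc => ?_
          have := block_eq_block_iff.mp h4 (c + 1) (by omega)
          convert this using 2 <;> ring
      · by_cases hx : x < d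
        · rw [Nat.add_assoc]
          exact hno (a + x) (by omega)
        · obtain ⟨y, rfl⟩ := Nat.exists_eq_add_of_le (not_lt.mp hx)
          obtain ⟨h1, h2⟩ := ih y (by omega)
          rw [← Nat.add_assoc]
          exact fun h3 => h2 (h3.of_block_eq h1.symm)
  refine h.1 ⟨b + a + m, d, hd, fun n hn => ?_⟩
  obtain ⟨x, rfl⟩ := Nat.exists_eq_add_of_le hn
  obtain ⟨h1, h2⟩ := key x
  by_contra h0
  refine h2 ⟨b + a + d + x, h1.symm, fun h4 => h0 ?_⟩
  convert h4 using 2 <;> ring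

/-- With c = t a, the word at a is cwc with w a palindrome and right special. A right special factor
of length m + 1 starts within this word and ends in w by uniqueness; the palindrome forces its first
letter to be c. -/
theorem IsSturmian.isRightSpecialAt_of_palindrome {t : ℕ → Fin 2} (h : IsSturmian t) {m a b : ℕ}
    (hab : t a ≠ t b) (hl : ∀ l, 1 ≤ l → l ≤ m → t (a + l) = t (b + l))
    (hpal : ∀ l, 1 ≤ l → l ≤ m → t (a + l) = t (a + (m + 1 - l)))
    (ha : t (a + (m + 1)) = t a) (hb : t (b + (m + 1)) = t b) :
    IsRightSpecialAt t (m + 1) a := by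
  obtain ⟨x, hx, hxs⟩ := h.exists_isRightSpecialAt_add (m + 1) a
  have h1 : IsRightSpecialAt t m (a + 1) := by
    refine ⟨b + 1, block_eq_block_iff.mpr fun c hc => ?_, ?_⟩
    · rw [Nat.add_assoc, Nat.add_assoc, hl (1 + c) (by omega) (by omega)]
    · rw [Nat.add_assoc, Nat.add_assoc, Nat.add_comm 1 m, ha, hb]
      exact hab.symm
  have h2 := h.block_eq_of_isRightSpecialAt hxs.suffix h1
  have h3 : t (a + x) = t a := by
    by_contra hne
    have hx0 : x ≠ 0 := by rintro rfl; exact hne rfl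
    have hxm : x ≠ m + 1 := by rintro rfl; exact hne ha
    have h4 := block_eq_block_iff.mp h2 (m - x) (by omega)
    rw [show a + x + 1 + (m - x) = a + (m + 1) by omega,
      show a + 1 + (m - x) = a + (m + 1 - x) by omega, ha,
      ← hpal x (by omega) (by omega)] at h4
    exact hne h4.symm
  refine hxs.of_block_eq (block_eq_block_iff.mpr fun c hc => ?_)
  rcases c with - | c
  · exact h3
  · have := block_eq_block_iff.mp h2 c (by omega)
    convert this using 2 <;> ring

/-- A shortest unbalanced pair has the form 0w0, 1w1 with w a palindrome. Then 0w and 1w are both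
right special, against uniqueness. -/
theorem IsSturmian.isBalanced {t : ℕ → Fin 2} (h : IsSturmian t) : IsBalanced t := by
  classical
  by_contra hun
  have hex : ∃ n, ¬ ∀ i j, zeros t (i + n) + zeros t j ≤ zeros t (j + n) + zeros t i + 1 := by
    simpa [IsBalanced] using hun
  have hmin := fun n (hn : n < Nat.find hex) => not_not.mp (Nat.find_min hex hn)
  have hbad := Nat.find_spec hex
  generalize Nat.find hex = n at hmin hbad
  push Not at hbad
  obtain ⟨i, j, hbad⟩ := hbad
  have hfin2 : ∀ {p q}, (t p = 0 ↔ t q = 0) → t p = t q := by intro p q; omega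
  have hs : ∀ p, zeros t (p + 1) = zeros t p + 1 ∧ t p = 0 ∨
      zeros t (p + 1) = zeros t p ∧ t p ≠ 0 := by
    intro p
    rw [zeros_succ]
    by_cases hp : t p = 0 <;> simp [hp]
  obtain ⟨m, rfl⟩ : ∃ m, n = m + 2 := by
    refine ⟨n - 2, ?_⟩
    have h0 : n ≠ 0 := by rintro rfl; simp at hbad; omega
    have h1 : n ≠ 1 := by
      rintro rfl
      have := hs i
      have := hs j
      omega
    omega
  have hone : ∀ l, 1 ≤ l → l ≤ m + 1 →
      zeros t (i + l) + zeros t j = zeros t (j + l) + zeros t i + 1 := by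
    intro l h1 h2
    have h3 := hmin l (by omega) i j
    have h4 := hmin (m + 2 - l) (by omega) (i + l) (j + l)
    rw [show i + l + (m + 2 - l) = i + (m + 2) by omega,
      show j + l + (m + 2 - l) = j + (m + 2) by omega] at h4
    omega
  have hi0 : t i = 0 ∧ t j ≠ 0 := by
    have := hone 1 le_rfl (by omega)
    have := hs i
    have := hs j
    omega
  have hi1 : t (i + (m + 1)) = 0 ∧ t (j + (m + 1)) ≠ 0 ∧
      zeros t (i + (m + 2)) + zeros t j = zeros t (j + (m + 2)) + zeros t i + 2 := by
    have := hone (m + 1) (by omega) le_rfl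
    have := hs (i + (m + 1))
    have := hs (j + (m + 1))
    simp only [Nat.add_assoc, Nat.reduceAdd] at *
    omega
  have hl : ∀ l, 1 ≤ l → l ≤ m → t (i + l) = t (j + l) := by
    intro l h1 h2
    have := hone l h1 (by omega)
    have := hone (l + 1) (by omega) (by omega)
    have := hs (i + l)
    have := hs (j + l)
    simp only [Nat.add_assoc] at *
    apply hfin2
    omega
  -- Comparing a prefix of one block with a suffix of the other, minimality shows that the prefix
  -- and suffix of length l of the block at i have equally many zeros; hence w is a palindrome.
  have hsum : ∀ l, 1 ≤ l → l ≤ m + 1 →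
      zeros t (i + l) + zeros t (i + (m + 2 - l)) = zeros t (i + (m + 2)) + zeros t i := by
    intro l h1 h2
    have h3 := hmin l (by omega) i (j + (m + 2 - l))
    have h4 := hmin l (by omega) (i + (m + 2 - l)) j
    rw [show j + (m + 2 - l) + l = j + (m + 2) by omega] at h3
    rw [show i + (m + 2 - l) + l = i + (m + 2) by omega] at h4
    have := hone l h1 h2
    have := hone (m + 2 - l) (by omega) (by omega)
    omega
  have hpal : ∀ l, 1 ≤ l → l ≤ m → t (i + l) = t (i + (m + 1 - l)) := by
    intro l h1 h2
    have h3 := hsum l h1 (by omega)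
    have h4 := hsum (l + 1) (by omega) (by omega)
    have h5 := hs (i + l)
    have h6 := hs (i + (m + 1 - l))
    rw [show m + 2 - (l + 1) = m + 1 - l by omega] at h4
    rw [show i + (m + 1 - l) + 1 = i + (m + 2 - l) by omega] at h6
    rw [← Nat.add_assoc] at h4
    apply hfin2
    omega
  have hne : t i ≠ t j := fun h0 => hi0.2 (h0 ▸ hi0.1)
  have hend : t (i + (m + 1)) = t i := by rw [hi1.1, hi0.1]
  have hend' : t (j + (m + 1)) = t j := by have := hi0.2; have := hi1.2.1; omega
  have r1 := h.isRightSpecialAt_of_palindrome hne hl hpal hend hend'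
  have r2 := h.isRightSpecialAt_of_palindrome hne.symm (fun l h1 h2 => (hl l h1 h2).symm)
    (fun l h1 h2 => by
      rw [← hl l h1 h2, hpal l h1 h2, hl (m + 1 - l) (by omega) (by omega)]) hend' hend
  have := block_eq_block_iff.mp (h.block_eq_of_isRightSpecialAt r1 r2) 0 (by omega)
  exact hne this

theorem IsSturmian.exists_irrational_hasSlope {t : ℕ → Fin 2} (h : IsSturmian t) :
    ∃ β, Irrational β ∧ HasSlope t β := by
  obtain ⟨β, hβ⟩ := h.isBalanced.exists_hasSlope
  exact ⟨β, h.isBalanced.irrational_of_isAperiodic h.1 hβ, hβ⟩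

/-! ### The periodic word of the statement -/

theorem omegaPower_eq_pairWord {k : ℕ} (hk : 1 ≤ k) :
    omegaPower (List.replicate (2 * k - 1) (0 : Fin 3) ++ [1, 1]) (by simp) =
      pairWord (2 * k + 1) 1 2 := by
  funext m
  have hlen : (List.replicate (2 * k - 1) (0 : Fin 3) ++ [1, 1]).length = 2 * k + 1 := by
    simp
    omega
  have hr : m % (2 * k + 1) < 2 * k + 1 := Nat.mod_lt _ (by omega)
  have hpair : IsPair (2 * k + 1) 1 (m + 2) ↔ ¬ m % (2 * k + 1) < 2 * k - 1 := by
    have hmod := mod_add_sub_eq hr (show 2 * k - 1 < 2 * k + 1 by omega)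
    rw [show 2 * k + 1 - (2 * k - 1) = 2 by omega] at hmod
    rw [IsPair, ← Nat.mod_add_mod, hmod]
    by_cases hle : 2 * k - 1 ≤ m % (2 * k + 1)
    · rw [if_pos hle]
      omega
    · rw [if_neg hle]
      omega
  simp only [omegaPower, hlen, pairWord, hpair, List.getElem_append, List.length_replicate]
  by_cases hlt : m % (2 * k + 1) < 2 * k - 1
  · simp [hlt]
  · simp only [hlt, dif_neg, not_false_eq_true, if_true]
    have hones : ∀ (g : ℕ) (hg : g < [(1 : Fin 3), 1].length), [(1 : Fin 3), 1][g] = 1 := by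
      intro g hg
      obtain rfl | rfl : g = 0 ∨ g = 1 := by simp at hg; omega
      all_goals rfl
    exact hones _ _

end AbelianClosure

/-- The three-letter alphabet is `Fin 3`; its letter `2` plays the role of `a`. -/
theorem mainTheorem10 (k : ℕ) (hk : 1 ≤ k) :
    (∃ x : ℕ → Fin 3, AbelianClosure.IsAperiodic x ∧
      AbelianClosure.IsUnionOfDistinctMinimalSubshifts k (AbelianClosure.abelianClosure x)) ∧
    (∀ s : ℕ → Fin 2, AbelianClosure.IsSturmian s →
      ∀ x : ℕ → Fin 3,
        x = AbelianClosure.substituteWords s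
          (AbelianClosure.omegaPower (List.replicate (2 * k - 1) (0 : Fin 3) ++ [1, 1]) (by simp))
          (AbelianClosure.omegaPower [(2 : Fin 3)] (by simp)) →
        AbelianClosure.IsAperiodic x ∧
        AbelianClosure.IsUnionOfDistinctMinimalSubshifts k
          (AbelianClosure.abelianClosure x)) := by
  open AbelianClosure in
  have key : ∀ (s : ℕ → Fin 2) (β : ℝ), Irrational β → HasSlope s β →
      IsAperiodic (fillZeros s (pairWord (2 * k + 1) 1 2)) ∧
        IsUnionOfDistinctMinimalSubshifts k
          (abelianClosure (fillZeros s (pairWord (2 * k + 1) 1 2))) := fun s β hβ hs =>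
    ⟨isAperiodic_fillZeros (hs.isAperiodic hβ) (pairWord_ne_two _ _ _),
      isUnionOfDistinctMinimalSubshifts_fillZeros hβ hs hk 2⟩
  constructor
  · have hirr : Irrational (√2 / 2) := by
      simpa using irrational_sqrt_two.div_natCast (m := 2) two_ne_zero
    obtain ⟨t, ht⟩ := AbelianClosure.exists_hasSlope (β := √2 / 2) (by positivity)
      (by linarith [Real.sqrt_two_lt_three_halves])
    exact ⟨_, key t _ hirr ht⟩
  · rintro s hs x rfl
    obtain ⟨β, hβ, hslope⟩ := hs.exists_irrational_hasSlope
    have h2 : AbelianClosure.omegaPower [(2 : Fin 3)] (by simp) = fun _ => 2 := by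
      funext m
      simp [AbelianClosure.omegaPower, Nat.mod_one]
    rw [h2, AbelianClosure.omegaPower_eq_pairWord hk,
      ← AbelianClosure.fillZeros_eq_substituteWords]
    exact key s β hβ hslope
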